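/- All graphs are finite, simple, undirected, and have at least one vertex. For a graph $G$ and $n \ge 1$, let $G^n$ be its $n$-th tensor power: the vertices are the $n$-tuples of vertices of $G$, and two tuples are adjacent iff they are adjacent in $G$ in every coordinate. Let $i(G)=\alpha(G)/|V(G)|$ be the independence ratio of $G$, where $\alpha(G)$ is its independence number, and let $$A(G)=\lim_{n\to\infty} i(G^n)$$ (the limit exists, since $i(G^n)$, $n\ge1$, is non-decreasing and bounded). Let $$a(G)=\max_{I}\frac{|I|}{|I|+|N(I)|},$$ where the maximum is over all nonempty independent sets $I$ of $G$, and $N(I)$ is the set of all vertices that have a neighbor in $I$. Let $G+H$ denote the disjoint union of $G$ and $H$. Let $G$ and $H$ be two vertex transitive graphs, where $H$ is isomorphic to one of the following: 1. a Kneser graph $KN_{n,k}$, $0\le k\le n$, whose vertices are the $k$-element subsets of $\{1,\ldots,n\}$, two distinct ones being adjacent iff they are disjoint; 2. a circular complete graph $K_{n/d}$, $d\ge 1$, $n\ge 2d$, whose vertex set is $\{0,\ldots,n-1\}$, with $i,j$ adjacent iff $d\le |i-j|\le n-d$; 3. a cycle $C_n$, $n\ge 3$; 4. a complete bipartite graph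 $K_{m,n}$. Then $$A(G+H)=a(G+H)=\max\{A(G),A(H)\}.$$ -/

import Mathlib

open Filter Topology

namespace TensorIndep

/-- The `n`-fold tensor (categorical) power `G ^ n`: the vertices are the `n`-tuples of vertices of
`G`, two tuples being adjacent iff they are adjacent in every coordinate.  For `1 ≤ n` the clause
`f ≠ g` follows from the other one; it only removes the loop at the single vertex of `G ^ 0`. -/
def tensorPow {V : Type*} (G : SimpleGraph V) (n : ℕ) : SimpleGraph (Fin n → V) where
  Adj f g := f ≠ g ∧ ∀ i, G.Adj (f i) (g i)
  symm := ⟨fun _ _ h => ⟨h.1.symm, fun i => (h.2 i).symm⟩⟩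
  loopless := ⟨fun _ h => h.1 rfl⟩

/-- The independence ratio `i(G) = α(G) / |V(G)|`. -/
noncomputable def indepRatio {V : Type*} [Fintype V] (G : SimpleGraph V) : ℝ :=
  (G.indepNum : ℝ) / (Fintype.card V : ℝ)

/-- The ultimate categorical independence ratio `A(G) = lim i(G ^ n)`; the limit exists, see
`tendsto_ultimateRatio`. -/
noncomputable def ultimateRatio {V : Type*} [Fintype V] (G : SimpleGraph V) : ℝ :=
  limUnder atTop (fun n : ℕ => indepRatio (tensorPow G n))

open Classical in
/-- The neighbourhood `N(I)`: all vertices that have a neighbour in `I`. -/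
noncomputable def nbhd {V : Type*} [Fintype V] (G : SimpleGraph V) (I : Finset V) : Finset V :=
  Finset.univ.filter (fun v => ∃ u ∈ I, G.Adj u v)

/-- The values `|I| / (|I| + |N(I)|)` for the nonempty independent sets `I` of `G`. -/
def expansionValues {V : Type*} [Fintype V] (G : SimpleGraph V) : Set ℝ :=
  {r | ∃ I : Finset V, I.Nonempty ∧ G.IsIndepSet (I : Set V) ∧
    r = (I.card : ℝ) / ((I.card : ℝ) + ((nbhd G I).card : ℝ))}

/-- `a(G)`, the maximum of `|I| / (|I| + |N(I)|)` over the nonempty independent sets `I` of `G`;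
the maximum is attained, see `isGreatest_expansionRatio`. -/
noncomputable def expansionRatio {V : Type*} [Fintype V] (G : SimpleGraph V) : ℝ :=
  sSup (expansionValues G)

/-- `G` is vertex transitive: its automorphisms act transitively on the vertices. -/
def VertexTransitive {V : Type*} (G : SimpleGraph V) : Prop :=
  ∀ u v : V, ∃ φ : G ≃g G, φ u = v

/-- The Kneser graph `KN_{n,k}`: the `k`-element subsets of an `n`-element set, two (distinct) ones
being adjacent iff they are disjoint. -/
def kneserGraph (n k : ℕ) : SimpleGraph {s : Finset (Fin n) // s.card = k} where
  Adj s t := s ≠ t ∧ Disjoint s.1 t.1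
  symm := ⟨fun _ _ h => ⟨h.1.symm, h.2.symm⟩⟩
  loopless := ⟨fun _ h => h.1 rfl⟩

/-- The circular complete graph `K_{n/d}` (used for `1 ≤ d` and `2 * d ≤ n`): the vertices are
`0, …, n - 1`, with `i`, `j` adjacent iff `d ≤ |i - j| ≤ n - d`. For `1 ≤ d` the clause `i ≠ j`
follows from the others. -/
def circularComplete (n d : ℕ) : SimpleGraph (Fin n) where
  Adj i j := i ≠ j ∧ (d : ℤ) ≤ |(i : ℤ) - (j : ℤ)| ∧ |(i : ℤ) - (j : ℤ)| ≤ (n : ℤ) - (d : ℤ)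
  symm := ⟨fun i j h => by
    rw [abs_sub_comm] at h
    exact ⟨h.1.symm, h.2⟩⟩
  loopless := ⟨fun _ h => h.1 rfl⟩

/-- `H` is, up to isomorphism, a Kneser graph. -/
def IsKneser {W : Type*} (H : SimpleGraph W) : Prop :=
  ∃ n k : ℕ, k ≤ n ∧ Nonempty (H ≃g kneserGraph n k)

/-- `H` is, up to isomorphism, a circular complete graph. -/
def IsCircularComplete {W : Type*} (H : SimpleGraph W) : Prop :=
  ∃ n d : ℕ, 1 ≤ d ∧ 2 * d ≤ n ∧ Nonempty (H ≃g circularComplete n d)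

/-- `H` is, up to isomorphism, a cycle `C_n`, `3 ≤ n`. -/
def IsCycleGraph {W : Type*} (H : SimpleGraph W) : Prop :=
  ∃ n : ℕ, 3 ≤ n ∧ Nonempty (H ≃g SimpleGraph.cycleGraph n)

/-- `H` is, up to isomorphism, a complete bipartite graph `K_{m,n}`. -/
def IsCompleteBipartite {W : Type*} (H : SimpleGraph W) : Prop :=
  ∃ m n : ℕ, Nonempty (H ≃g completeBipartiteGraph (Fin m) (Fin n))

/-- `i(G ^ n) ≤ i(G ^ (n + 1))` for `1 ≤ n`. -/
theorem indepRatio_tensorPow_le {V : Type*} [Fintype V] [Nonempty V] (G : SimpleGraph V) (n : ℕ) :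
    indepRatio (tensorPow G (n + 1)) ≤ indepRatio (tensorPow G (n + 2)) := by
  classical
  obtain ⟨s, hs⟩ := (tensorPow G (n + 1)).exists_isNIndepSet_indepNum
  have hV : (0 : ℝ) < Fintype.card V := by exact_mod_cast Fintype.card_pos
  let e := Fin.snocEquiv (fun _ : Fin (n + 2) => V)
  let t : Finset (Fin (n + 2) → V) := (Finset.univ ×ˢ s).map e.toEmbedding
  have ht : (tensorPow G (n + 2)).IsIndepSet (t : Set (Fin (n + 2) → V)) := by
    intro f hf g hg _ hadj
    simp only [t, Finset.coe_map, Set.mem_image, Finset.mem_coe, Finset.mem_product] at hf hg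
    obtain ⟨⟨x, f'⟩, ⟨-, hf'⟩, rfl⟩ := hf
    obtain ⟨⟨y, g'⟩, ⟨-, hg'⟩, rfl⟩ := hg
    have h : ∀ i, G.Adj (f' i) (g' i) := fun i => by
      have := hadj.2 (Fin.castSucc i)
      simpa [e, Fin.snocEquiv] using this
    have hne : f' ≠ g' := fun h0 => (h 0).ne (congrFun h0 0)
    exact hs.isIndepSet hf' hg' hne ⟨hne, h⟩
  have hc := ht.card_le_indepNum
  have hct : t.card = Fintype.card V * (tensorPow G (n + 1)).indepNum := by
    simp [t, Finset.card_product, hs.card_eq]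
  rw [hct] at hc
  have hc' : (Fintype.card V : ℝ) * (tensorPow G (n + 1)).indepNum
      ≤ (tensorPow G (n + 2)).indepNum := by exact_mod_cast hc
  unfold indepRatio
  simp only [Fintype.card_fun, Fintype.card_fin, Nat.cast_pow]
  rw [div_le_div_iff₀ (by positivity) (by positivity)]
  calc _ = ((Fintype.card V : ℝ) * (tensorPow G (n + 1)).indepNum)
        * (Fintype.card V : ℝ) ^ (n + 1) := by ring
    _ ≤ _ := by gcongr

theorem indepRatio_le_one {V : Type*} [Fintype V] (G : SimpleGraph V) : indepRatio G ≤ 1 := by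
  obtain ⟨s, hs⟩ := G.exists_isNIndepSet_indepNum
  unfold indepRatio
  apply div_le_one_of_le₀ _ (by positivity)
  rw [← hs.card_eq]
  exact_mod_cast s.card_le_univ

/-- The limit that defines `A(G)` exists. -/
theorem tendsto_ultimateRatio {V : Type*} [Fintype V] [Nonempty V] (G : SimpleGraph V) :
    Tendsto (fun n : ℕ => indepRatio (tensorPow G n)) atTop (𝓝 (ultimateRatio G)) := by
  have hm : Monotone (fun n : ℕ => indepRatio (tensorPow G (n + 1))) :=
    monotone_nat_of_le_succ (fun n => indepRatio_tensorPow_le G n)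
  have hb : BddAbove (Set.range (fun n : ℕ => indepRatio (tensorPow G (n + 1)))) :=
    ⟨1, by rintro _ ⟨n, rfl⟩; exact indepRatio_le_one _⟩
  have h := tendsto_atTop_ciSup hm hb
  exact tendsto_nhds_limUnder
    ⟨_, (tendsto_add_atTop_iff_nat (f := fun n : ℕ => indepRatio (tensorPow G n)) 1).1 h⟩

/-- The maximum that defines `a(G)` is attained. -/
theorem isGreatest_expansionRatio {V : Type*} [Fintype V] [Nonempty V] (G : SimpleGraph V) :
    IsGreatest (expansionValues G) (expansionRatio G) := by
  classical
  have hfin : (expansionValues G).Finite := by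
    refine (Set.finite_range (fun I : Finset V =>
      (I.card : ℝ) / ((I.card : ℝ) + ((nbhd G I).card : ℝ)))).subset ?_
    rintro _ ⟨I, -, -, rfl⟩
    exact ⟨I, rfl⟩
  have hne : (expansionValues G).Nonempty := by
    obtain ⟨v⟩ := ‹Nonempty V›
    exact ⟨_, {v}, Finset.singleton_nonempty v, by simp [SimpleGraph.IsIndepSet], rfl⟩
  exact ⟨hne.csSup_mem hfin, fun _ hr => le_csSup hfin.bddAbove hr⟩

end TensorIndep

/-! Everything follows from the cycle of inequalities A(G+H) ≤ i(G×H) ≤ max(a(G), a(H)) ≤ a(G+H) ≤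
A(G+H), where G×H is the tensor product. The first step is averaging (`ultimateRatio_sum_le`): G×H
maps to G and to H, hence to G+H. By vertex transitivity, the maps through both summands form a
finite family hitting every vertex of G+H equally often. Independently chosen members of the family
map G×H uniformly to every power of G+H; pulling back a maximum independent set and averaging bounds
the ratio of the power by i(G×H). The second step (`indepRatio_tensorProd_le`) splits an independent
set of G×H into a part that expands along G and a part that expands along H. The third holds because
neighbourhoods in a summand stay in that summand, and the last (`expansionRatio_le_ultimateRatio`)
is a recursive construction in the powers. The same averaging over automorphisms gives A = i = a for
a single vertex transitive graph, which turns a(G), a(H) into A(G), A(H). -/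

namespace TensorIndep

/-- The tensor (categorical) product of two graphs. -/
def tensorProd {V W : Type*} (G : SimpleGraph V) (H : SimpleGraph W) : SimpleGraph (V × W) where
  Adj p q := G.Adj p.1 q.1 ∧ H.Adj p.2 q.2
  symm := ⟨fun _ _ h => ⟨h.1.symm, h.2.symm⟩⟩
  loopless := ⟨fun _ h => h.1.ne rfl⟩

theorem mem_nbhd {V : Type*} [Fintype V] {G : SimpleGraph V} {I : Finset V} {v : V} :
    v ∈ nbhd G I ↔ ∃ u ∈ I, G.Adj u v := by
  simp [nbhd]

theorem not_adj_of_isIndepSet {V : Type*} {G : SimpleGraph V} {I : Finset V}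
    (hI : G.IsIndepSet (I : Set V)) {u v : V} (hu : u ∈ I) (hv : v ∈ I) : ¬ G.Adj u v :=
  fun h => hI hu hv h.ne h

theorem isIndepSet_of_not_adj {V : Type*} {G : SimpleGraph V} {I : Finset V}
    (hI : ∀ u ∈ I, ∀ v ∈ I, ¬ G.Adj u v) : G.IsIndepSet (I : Set V) :=
  fun _ hu _ hv _ => hI _ hu _ hv

theorem disjoint_nbhd {V : Type*} [Fintype V] {G : SimpleGraph V} {I : Finset V}
    (hI : G.IsIndepSet (I : Set V)) : Disjoint I (nbhd G I) := by
  rw [Finset.disjoint_left]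
  intro v hv hn
  obtain ⟨u, hu, h⟩ := mem_nbhd.1 hn
  exact not_adj_of_isIndepSet hI hu hv h

/-! ### Bounds on the expansion ratio -/

/-- Free of division, this form includes I = ∅ and can be summed over slices, some of which may be
empty. -/
theorem card_le_expansionRatio_mul {V : Type*} [Fintype V] [Nonempty V] {G : SimpleGraph V}
    {I : Finset V} (hI : G.IsIndepSet (I : Set V)) :
    (I.card : ℝ) ≤ expansionRatio G * ((I.card : ℝ) + ((nbhd G I).card : ℝ)) := by
  have hbound := (isGreatest_expansionRatio G).2
  rcases I.eq_empty_or_nonempty with rfl | hne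
  · have : nbhd G ∅ = ∅ := by simp [nbhd]
    simp [this]
  · have hpos : (0 : ℝ) < I.card := by exact_mod_cast hne.card_pos
    exact (div_le_iff₀ (by positivity)).1 (hbound ⟨I, hne, hI, rfl⟩)

theorem expansionRatio_le_of_forall {V : Type*} [Fintype V] [Nonempty V] {G : SimpleGraph V}
    {a : ℝ} (h : ∀ I : Finset V, I.Nonempty → G.IsIndepSet (I : Set V) →
      (I.card : ℝ) / ((I.card : ℝ) + ((nbhd G I).card : ℝ)) ≤ a) : expansionRatio G ≤ a := by
  obtain ⟨I, hne, hI, hr⟩ := (isGreatest_expansionRatio G).1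
  rw [hr]
  exact h I hne hI

theorem expansionRatio_nonneg {V : Type*} [Fintype V] [Nonempty V] (G : SimpleGraph V) :
    0 ≤ expansionRatio G := by
  obtain ⟨I, -, -, hr⟩ := (isGreatest_expansionRatio G).1
  rw [hr]
  positivity

theorem indepRatio_le_expansionRatio {V : Type*} [Fintype V] [Nonempty V] (G : SimpleGraph V) :
    indepRatio G ≤ expansionRatio G := by
  classical
  obtain ⟨I, hI⟩ := G.exists_isNIndepSet_indepNum
  have hV : (0 : ℝ) < Fintype.card V := by exact_mod_cast Fintype.card_pos
  have h := card_le_expansionRatio_mul hI.isIndepSet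
  have hle : I.card + (nbhd G I).card ≤ Fintype.card V := by
    rw [← Finset.card_union_of_disjoint (disjoint_nbhd hI.isIndepSet)]
    exact Finset.card_le_univ _
  have hle' : (I.card : ℝ) + (nbhd G I).card ≤ Fintype.card V := by exact_mod_cast hle
  unfold indepRatio
  rw [div_le_iff₀ hV, ← hI.card_eq]
  exact h.trans (mul_le_mul_of_nonneg_left hle' (expansionRatio_nonneg G))

/-- An adjacency-reflecting embedding onto a union of components does not decrease the
expansion ratio. -/
theorem expansionRatio_le_of_embedding {V X : Type*} [Fintype V] [Nonempty V] [Fintype X]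
    [Nonempty X] {G : SimpleGraph V} {K : SimpleGraph X} (e : V ↪ X)
    (hadj : ∀ u v, K.Adj (e u) (e v) ↔ G.Adj u v)
    (hclosed : ∀ u x, K.Adj (e u) x → x ∈ Set.range e) :
    expansionRatio G ≤ expansionRatio K := by
  classical
  refine expansionRatio_le_of_forall fun I hne hI => (isGreatest_expansionRatio K).2
    ⟨I.map e, hne.map, ?_, ?_⟩
  · refine isIndepSet_of_not_adj ?_
    simp only [Finset.mem_map, forall_exists_index, and_imp]
    rintro _ u hu rfl _ v hv rfl
    rw [hadj]
    exact not_adj_of_isIndepSet hI hu hv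
  · have : nbhd K (I.map e) = (nbhd G I).map e := by
      ext x
      simp only [mem_nbhd, Finset.mem_map]
      constructor
      · rintro ⟨_, ⟨u, hu, rfl⟩, h⟩
        obtain ⟨v, rfl⟩ := hclosed u x h
        exact ⟨v, ⟨u, hu, (hadj u v).1 h⟩, rfl⟩
      · rintro ⟨v, ⟨u, hu, h⟩, rfl⟩
        exact ⟨e u, ⟨u, hu, rfl⟩, (hadj u v).2 h⟩
    rw [this, Finset.card_map, Finset.card_map]

theorem max_expansionRatio_le_sum {V W : Type*} [Fintype V] [Nonempty V] [Fintype W] [Nonempty W]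
    (G : SimpleGraph V) (H : SimpleGraph W) :
    max (expansionRatio G) (expansionRatio H) ≤ expansionRatio (G ⊕g H) := by
  refine max_le (expansionRatio_le_of_embedding Function.Embedding.inl ?_ ?_)
    (expansionRatio_le_of_embedding Function.Embedding.inr ?_ ?_)
  · simp
  · rintro u (v | w) h <;> simp_all
  · simp
  · rintro u (v | w) h <;> simp_all

/-! ### The independence ratio of a tensor product -/

theorem card_filter_fst_mem {V W : Type*} [DecidableEq V] [Fintype V] [Fintype W]
    (F : W → Finset V) :
    (Finset.univ.filter fun p : V × W => p.1 ∈ F p.2).card = ∑ y, (F y).card := by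
  rw [← Finset.card_sigma]
  refine Finset.card_bij' (fun p _ => ⟨p.2, p.1⟩) (fun s _ => (s.2, s.1)) ?_ ?_ ?_ ?_ <;> simp

theorem card_filter_snd_mem {V W : Type*} [DecidableEq W] [Fintype V] [Fintype W]
    (F : V → Finset W) :
    (Finset.univ.filter fun p : V × W => p.2 ∈ F p.1).card = ∑ x, (F x).card := by
  rw [← Finset.card_sigma]
  refine Finset.card_bij' (fun p _ => ⟨p.1, p.2⟩) (fun s _ => (s.1, s.2)) ?_ ?_ ?_ ?_ <;> simp

/-- `i(G × H) ≤ max {a(G), a(H)}`.  An independent set `U` splits into the points that are isolated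
in their slice parallel to `G` and the others; the former expand in the direction of `G`, the
latter in that of `H`, and the neighbourhoods so obtained are disjoint. -/
theorem indepRatio_tensorProd_le {V W : Type*} [Fintype V] [Nonempty V] [Fintype W] [Nonempty W]
    (G : SimpleGraph V) (H : SimpleGraph W) :
    indepRatio (tensorProd G H) ≤ max (expansionRatio G) (expansionRatio H) := by
  classical
  obtain ⟨U, hU⟩ := (tensorProd G H).exists_isNIndepSet_indepNum
  have hind : ∀ {x x' y y'}, (x, y) ∈ U → (x', y') ∈ U → G.Adj x x' → H.Adj y y' → False :=
    fun h h' hx hy => not_adj_of_isIndepSet hU.isIndepSet h h' ⟨hx, hy⟩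
  set a := max (expansionRatio G) (expansionRatio H)
  let I : W → Finset V := fun y =>
    Finset.univ.filter fun x => (x, y) ∈ U ∧ ∀ x', G.Adj x x' → (x', y) ∉ U
  let R : V → Finset W := fun x =>
    Finset.univ.filter fun y => (x, y) ∈ U ∧ ∃ x', G.Adj x x' ∧ (x', y) ∈ U
  have memI : ∀ {x y}, x ∈ I y ↔ (x, y) ∈ U ∧ ∀ x', G.Adj x x' → (x', y) ∉ U := by simp [I]
  have memR : ∀ {x y}, y ∈ R x ↔ (x, y) ∈ U ∧ ∃ x', G.Adj x x' ∧ (x', y) ∈ U := by simp [R]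
  have hI : ∀ y, G.IsIndepSet (I y : Set V) := fun y => isIndepSet_of_not_adj
    fun u hu v hv h => (memI.1 hu).2 v h (memI.1 hv).1
  -- If y and y' in R x were adjacent, a witness (x', y) ∈ U with x' adjacent to x would be adjacent
  -- to (x, y') ∈ U.
  have hR : ∀ x, H.IsIndepSet (R x : Set W) := fun x => isIndepSet_of_not_adj
    fun u hu v hv h => by
      obtain ⟨-, x', hx', hmem⟩ := memR.1 hu
      exact hind hmem (memR.1 hv).1 hx'.symm h
  let A₁ := Finset.univ.filter fun p : V × W => p.1 ∈ I p.2
  let N₁ := Finset.univ.filter fun p : V × W => p.1 ∈ nbhd G (I p.2)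
  let A₂ := Finset.univ.filter fun p : V × W => p.2 ∈ R p.1
  let N₂ := Finset.univ.filter fun p : V × W => p.2 ∈ nbhd H (R p.1)
  have hUA : U = A₁ ∪ A₂ := by
    ext ⟨x, y⟩
    simp only [A₁, A₂, Finset.mem_union, Finset.mem_filter, Finset.mem_univ, true_and, memI, memR]
    constructor
    · intro h
      by_cases hx : ∃ x', G.Adj x x' ∧ (x', y) ∈ U
      · exact Or.inr ⟨h, hx⟩
      · exact Or.inl ⟨h, fun x' hx' hmem => hx ⟨x', hx', hmem⟩⟩
    · rintro (h | h) <;> exact h.1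
  have hA : Disjoint A₁ A₂ := by
    rw [Finset.disjoint_left]
    rintro ⟨x, y⟩ h₁ h₂
    simp only [A₁, A₂, Finset.mem_filter, Finset.mem_univ, true_and, memI, memR] at h₁ h₂
    obtain ⟨-, x', hx', hmem⟩ := h₂
    exact h₁.2 x' hx' hmem
  -- A common point (x, y) would give (x', y) and (x, y') in U with x' adjacent to x and y' to y, an
  -- edge inside U.
  have hN : Disjoint N₁ N₂ := by
    rw [Finset.disjoint_left]
    rintro ⟨x, y⟩ h₁ h₂
    simp only [N₁, N₂, Finset.mem_filter, Finset.mem_univ, true_and, mem_nbhd, memI, memR] at h₁ h₂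
    obtain ⟨x', ⟨hx', -⟩, hadj⟩ := h₁
    obtain ⟨y', ⟨hy', -⟩, hadj'⟩ := h₂
    exact hind hx' hy' hadj hadj'.symm
  have hAN : Disjoint (A₁ ∪ A₂) (N₁ ∪ N₂) := by
    rw [← hUA, Finset.disjoint_left]
    rintro ⟨x, y⟩ h h'
    simp only [N₁, N₂, Finset.mem_union, Finset.mem_filter, Finset.mem_univ, true_and, mem_nbhd,
      memI, memR] at h'
    rcases h' with ⟨x', ⟨-, hx'⟩, hadj⟩ | ⟨y', ⟨-, x', hx', hmem⟩, hadj⟩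
    · exact hx' x hadj h
    · exact hind hmem h hx'.symm hadj
  have hcardU : (U.card : ℝ) = A₁.card + A₂.card := by
    rw [hUA, Finset.card_union_of_disjoint hA]
    push_cast
    rfl
  have htotal : (A₁.card : ℝ) + A₂.card + (N₁.card + N₂.card) ≤ Fintype.card (V × W) := by
    have h := Finset.card_le_univ ((A₁ ∪ A₂) ∪ (N₁ ∪ N₂))
    rw [Finset.card_union_of_disjoint hAN, Finset.card_union_of_disjoint hA,
      Finset.card_union_of_disjoint hN] at h
    exact_mod_cast h
  have h₁ : (A₁.card : ℝ) ≤ a * (A₁.card + N₁.card) := by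
    have hA₁ : A₁.card = ∑ y, (I y).card := card_filter_fst_mem I
    have hN₁ : N₁.card = ∑ y, (nbhd G (I y)).card :=
      card_filter_fst_mem fun y => nbhd G (I y)
    rw [hA₁, hN₁]
    push_cast
    rw [← Finset.sum_add_distrib, Finset.mul_sum]
    refine Finset.sum_le_sum fun y _ => (card_le_expansionRatio_mul (hI y)).trans ?_
    exact mul_le_mul_of_nonneg_right (le_max_left _ _)
      (add_nonneg (Nat.cast_nonneg _) (Nat.cast_nonneg _))
  have h₂ : (A₂.card : ℝ) ≤ a * (A₂.card + N₂.card) := by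
    have hA₂ : A₂.card = ∑ x, (R x).card := card_filter_snd_mem R
    have hN₂ : N₂.card = ∑ x, (nbhd H (R x)).card :=
      card_filter_snd_mem fun x => nbhd H (R x)
    rw [hA₂, hN₂]
    push_cast
    rw [← Finset.sum_add_distrib, Finset.mul_sum]
    refine Finset.sum_le_sum fun x _ => (card_le_expansionRatio_mul (hR x)).trans ?_
    exact mul_le_mul_of_nonneg_right (le_max_right _ _)
      (add_nonneg (Nat.cast_nonneg _) (Nat.cast_nonneg _))
  have ha : 0 ≤ a := (expansionRatio_nonneg G).trans (le_max_left _ _)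
  have hpos : (0 : ℝ) < Fintype.card (V × W) := by exact_mod_cast Fintype.card_pos
  unfold indepRatio
  rw [div_le_iff₀ hpos, ← hU.card_eq]
  calc (U.card : ℝ) ≤ a * (A₁.card + A₂.card + (N₁.card + N₂.card)) := by
        rw [hcardU]
        linarith
    _ ≤ _ := mul_le_mul_of_nonneg_left htotal ha

/-! ### Lower bound for the ultimate ratio -/

/-- Let P be the complement of J ∪ N(J). No edge joins J to P, so one may take all tuples with first
coordinate in J, and those with first coordinate in P whose remaining coordinates lie in a maximum
independent set of the previous power. -/
theorem indepRatio_tensorPow_succ_ge {X : Type*} [Fintype X] [Nonempty X] (K : SimpleGraph X)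
    {J : Finset X} (hJ : K.IsIndepSet (J : Set X)) (n : ℕ) :
    ((J.card : ℝ) + (Fintype.card X - (J.card + (nbhd K J).card)) *
      indepRatio (tensorPow K (n + 1))) / Fintype.card X ≤ indepRatio (tensorPow K (n + 2)) := by
  classical
  obtain ⟨s, hs⟩ := (tensorPow K (n + 1)).exists_isNIndepSet_indepNum
  have hX : (0 : ℝ) < Fintype.card X := by exact_mod_cast Fintype.card_pos
  let e := Fin.consEquiv (fun _ : Fin (n + 2) => X)
  let P : Finset X := (J ∪ nbhd K J)ᶜ
  let T : Finset (X × (Fin (n + 1) → X)) := J ×ˢ Finset.univ ∪ P ×ˢ s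
  have hPJ : ∀ {x y}, x ∈ P → y ∈ J → ¬ K.Adj y x := fun {x y} hx hy h => by
    simp only [P, Finset.mem_compl, Finset.mem_union, not_or, mem_nbhd] at hx
    exact hx.2 ⟨y, hy, h⟩
  have ht : (tensorPow K (n + 2)).IsIndepSet
      ((T.map e.toEmbedding : Finset (Fin (n + 2) → X)) : Set (Fin (n + 2) → X)) := by
    refine isIndepSet_of_not_adj ?_
    simp only [Finset.mem_map, Equiv.coe_toEmbedding, forall_exists_index, and_imp]
    rintro _ ⟨x, f⟩ hf rfl _ ⟨y, g⟩ hg rfl hadj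
    have h0 : K.Adj x y := by simpa [e, Fin.consEquiv] using hadj.2 0
    have h : ∀ i, K.Adj (f i) (g i) := fun i => by
      simpa [e, Fin.consEquiv] using hadj.2 (Fin.succ i)
    simp only [T, Finset.mem_union, Finset.mem_product, Finset.mem_univ, and_true] at hf hg
    rcases hf with hx | ⟨hx, hf⟩ <;> rcases hg with hy | ⟨hy, hg⟩
    · exact not_adj_of_isIndepSet hJ hx hy h0
    · exact hPJ hy hx h0
    · exact hPJ hx hy h0.symm
    -- Coordinate 0 exists because the exponent is n + 1; it shows that the two tails are distinct.
    · exact not_adj_of_isIndepSet hs.isIndepSet hf hg ⟨fun h0 => (h 0).ne (congrFun h0 0), h⟩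
  have hc := ht.card_le_indepNum
  have hdisj : Disjoint (J ×ˢ (Finset.univ : Finset (Fin (n + 1) → X))) (P ×ˢ s) := by
    refine Finset.disjoint_product.2 (Or.inl ?_)
    rw [Finset.disjoint_left]
    intro x hx hP
    simp only [P, Finset.mem_compl, Finset.mem_union, not_or] at hP
    exact hP.1 hx
  have hP : (P.card : ℝ) = Fintype.card X - (J.card + (nbhd K J).card) := by
    have h := Finset.card_compl_add_card (J ∪ nbhd K J)
    rw [Finset.card_union_of_disjoint (disjoint_nbhd hJ)] at h
    rw [← h]
    push_cast
    ring
  have hc' : (J.card : ℝ) * (Fintype.card X : ℝ) ^ (n + 1)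
      + P.card * (tensorPow K (n + 1)).indepNum ≤ (tensorPow K (n + 2)).indepNum := by
    rw [Finset.card_map, Finset.card_union_of_disjoint hdisj, Finset.card_product,
      Finset.card_product, hs.card_eq, Finset.card_univ, Fintype.card_fun, Fintype.card_fin] at hc
    exact_mod_cast hc
  rw [← hP]
  unfold indepRatio
  simp only [Fintype.card_fun, Fintype.card_fin, Nat.cast_pow]
  rw [div_le_div_iff₀ hX (by positivity)]
  calc _ = ((J.card : ℝ) * (Fintype.card X : ℝ) ^ (n + 1)
      + P.card * (tensorPow K (n + 1)).indepNum) * Fintype.card X := by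
        field_simp
        ring
    _ ≤ _ := by gcongr

/-- `a(K) ≤ A(K)`. -/
theorem expansionRatio_le_ultimateRatio {X : Type*} [Fintype X] [Nonempty X] (K : SimpleGraph X) :
    expansionRatio K ≤ ultimateRatio K := by
  refine expansionRatio_le_of_forall fun J hne hJ => ?_
  have hX : (0 : ℝ) < Fintype.card X := by exact_mod_cast Fintype.card_pos
  have hpos : (0 : ℝ) < J.card := by exact_mod_cast hne.card_pos
  have hlim := tendsto_ultimateRatio K
  have h₁ := (tendsto_add_atTop_iff_nat 1).2 hlim
  have h₂ := (tendsto_add_atTop_iff_nat 2).2 hlim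
  -- In the limit A is at least its image under an affine map with fixed point |J| / (|J| + |N(J)|)
  -- and slope less than 1.
  have h := le_of_tendsto_of_tendsto'
    (((h₁.const_mul ((Fintype.card X : ℝ) - (J.card + (nbhd K J).card))).const_add
      (J.card : ℝ)).div_const (Fintype.card X : ℝ)) h₂
    (fun n => indepRatio_tensorPow_succ_ge K hJ n)
  rw [div_le_iff₀ hX] at h
  rw [div_le_iff₀ (by positivity)]
  linarith

/-! ### Upper bound for the ultimate ratio -/

/-- If a finite family of homomorphisms `L → K` sends every vertex of `L` to every vertex of `K`
equally often, then `i(K) ≤ i(L)`. -/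
theorem indepRatio_le_of_uniform {S Y X : Type*} [Fintype S] [Nonempty S] [Fintype Y] [Nonempty Y]
    [Fintype X] [Nonempty X] [DecidableEq X] {L : SimpleGraph Y} {K : SimpleGraph X}
    (φ : S → L →g K) (c : ℕ) (hφ : ∀ y x, (Finset.univ.filter fun s => φ s y = x).card = c) :
    indepRatio K ≤ indepRatio L := by
  classical
  obtain ⟨U, hU⟩ := K.exists_isNIndepSet_indepNum
  have hfiber : ∀ s, (Finset.univ.filter fun y => φ s y ∈ U).card ≤ L.indepNum := fun s => by
    refine SimpleGraph.IsIndepSet.card_le_indepNum (isIndepSet_of_not_adj ?_)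
    simp only [Finset.mem_filter, Finset.mem_univ, true_and]
    exact fun u hu v hv h => not_adj_of_isIndepSet hU.isIndepSet hu hv ((φ s).map_rel h)
  have hmem : ∀ (T : Finset X) y, (Finset.univ.filter fun s => φ s y ∈ T).card = T.card * c := by
    intro T y
    rw [Finset.card_eq_sum_card_fiberwise (f := fun s => φ s y) (t := T)
      (fun s hs => by simpa using hs), ← smul_eq_mul, ← Finset.sum_const]
    refine Finset.sum_congr rfl fun x hx => ?_
    rw [← hφ y x, Finset.filter_filter]
    congr 1
    ext s
    simp only [Finset.mem_filter, Finset.mem_univ, true_and, and_iff_right_iff_imp]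
    rintro rfl
    exact hx
  have hS : Fintype.card S = Fintype.card X * c := by
    obtain ⟨y⟩ := ‹Nonempty Y›
    simpa using hmem Finset.univ y
  have hc : 0 < c := Nat.pos_of_mul_pos_left (hS ▸ Fintype.card_pos)
  -- Double count the pairs (s, y) with φ s y ∈ U: each y lies in |U| c of them, and each s in at
  -- most α(L), since preimages of independent sets are independent.
  have hcount : Fintype.card Y * (U.card * c) ≤ Fintype.card X * c * L.indepNum := by
    calc Fintype.card Y * (U.card * c)
        = ∑ y : Y, (Finset.univ.filter fun s => φ s y ∈ U).card := by
          simp [hmem]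
      _ = ∑ s : S, (Finset.univ.filter fun y => φ s y ∈ U).card := by
          simp only [Finset.card_filter]
          exact Finset.sum_comm
      _ ≤ ∑ _s : S, L.indepNum := Finset.sum_le_sum fun s _ => hfiber s
      _ = Fintype.card X * c * L.indepNum := by simp [hS]
  have hcount' : U.card * Fintype.card Y ≤ L.indepNum * Fintype.card X := by
    refine Nat.le_of_mul_le_mul_left ?_ hc
    linarith
  have hX : (0 : ℝ) < Fintype.card X := by exact_mod_cast Fintype.card_pos
  have hY : (0 : ℝ) < Fintype.card Y := by exact_mod_cast Fintype.card_pos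
  unfold indepRatio
  rw [div_le_div_iff₀ hX hY, ← hU.card_eq]
  exact_mod_cast hcount'

/-- A uniform family of homomorphisms `L → K` bounds the ultimate ratio: its powers are uniform
families of homomorphisms `L → K ^ n`. -/
theorem ultimateRatio_le_of_uniform {S Y X : Type*} [Fintype S] [Nonempty S] [Fintype Y]
    [Nonempty Y] [Fintype X] [Nonempty X] [DecidableEq X] {L : SimpleGraph Y} {K : SimpleGraph X}
    (φ : S → L →g K) (c : ℕ)
    (hφ : ∀ y x, (Finset.univ.filter fun s => φ s y = x).card = c) :
    ultimateRatio K ≤ indepRatio L := by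
  -- The shift skips the power 0, a single loopless vertex of ratio 1.
  refine le_of_tendsto' ((tendsto_add_atTop_iff_nat 1).2 (tendsto_ultimateRatio K)) fun n => ?_
  refine indepRatio_le_of_uniform (S := Fin (n + 1) → S)
    (fun s => (⟨fun y i => φ (s i) y, fun {u v} h => ?_⟩ : L →g tensorPow K (n + 1)))
    (c ^ (n + 1)) fun y x => ?_
  · have h' : ∀ i, K.Adj (φ (s i) u) (φ (s i) v) := fun i => (φ (s i)).map_rel h
    exact ⟨fun h0 => (h' 0).ne (congrFun h0 0), h'⟩
  · have : (Finset.univ.filter fun s : Fin (n + 1) → S => (fun i => φ (s i) y) = x)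
        = Fintype.piFinset fun i => Finset.univ.filter fun s => φ s y = x i := by
      ext s
      simp [funext_iff]
    change (Finset.univ.filter fun s : Fin (n + 1) → S => (fun i => φ (s i) y) = x).card = _
    rw [this, Fintype.card_piFinset]
    simp [hφ]

/-! ### Vertex transitive graphs and their disjoint unions -/

/-- Composing with an automorphism taking u' to u before, and one taking v to v' after, is a
bijection between the two sets. -/
theorem VertexTransitive.card_filter_apply_eq {V : Type*} [DecidableEq V] {G : SimpleGraph V}
    [Fintype (G ≃g G)] (hG : VertexTransitive G) (u v u' v' : V) :
    (Finset.univ.filter fun σ : G ≃g G => σ u = v).card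
      = (Finset.univ.filter fun σ : G ≃g G => σ u' = v').card := by
  obtain ⟨α, hα⟩ := hG u' u
  obtain ⟨β, hβ⟩ := hG v v'
  refine Finset.card_bij' (fun σ _ => (α.trans σ).trans β)
    (fun σ _ => (α.symm.trans σ).trans β.symm) ?_ ?_ ?_ ?_
  · intro σ hσ
    simp_all
  · intro σ hσ
    have h₁ : α.symm u = u' := by rw [← hα]; simp
    have h₂ : β.symm v' = v := by rw [← hβ]; simp
    simp_all
  · intro σ _
    ext x
    simp
  · intro σ _
    ext x
    simp

/-- The common number of automorphisms with a prescribed value at a prescribed vertex. -/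
theorem VertexTransitive.exists_card_filter {V : Type*} [Fintype V] [Nonempty V] [DecidableEq V]
    {G : SimpleGraph V} [Fintype (G ≃g G)] (hG : VertexTransitive G) :
    ∃ c : ℕ, (∀ u v, (Finset.univ.filter fun σ : G ≃g G => σ u = v).card = c) ∧
      Fintype.card V * c = Fintype.card (G ≃g G) := by
  obtain ⟨v⟩ := ‹Nonempty V›
  refine ⟨_, fun u w => hG.card_filter_apply_eq u w v v, ?_⟩
  have h := Finset.card_eq_sum_card_fiberwise (s := (Finset.univ : Finset (G ≃g G)))
    (f := fun σ => σ v) (t := Finset.univ) (fun _ _ => by simp)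
  rw [Finset.sum_congr rfl fun w _ => hG.card_filter_apply_eq v w v v] at h
  rw [← Finset.card_univ (α := G ≃g G), h]
  simp

/-- The automorphisms are a uniform family of homomorphisms from G to itself. -/
theorem ultimateRatio_le_indepRatio {V : Type*} [Fintype V] [Nonempty V] {G : SimpleGraph V}
    (hG : VertexTransitive G) : ultimateRatio G ≤ indepRatio G := by
  classical
  have : Finite (G ≃g G) := DFunLike.finite _
  have := Fintype.ofFinite (G ≃g G)
  obtain ⟨c, hc, -⟩ := hG.exists_card_filter
  have : Nonempty (G ≃g G) := ⟨SimpleGraph.Iso.refl⟩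
  exact ultimateRatio_le_of_uniform (fun σ : G ≃g G => σ.toHom) c hc

theorem VertexTransitive.ultimateRatio_eq {V : Type*} [Fintype V] [Nonempty V]
    {G : SimpleGraph V} (hG : VertexTransitive G) : ultimateRatio G = expansionRatio G :=
  le_antisymm ((ultimateRatio_le_indepRatio hG).trans (indepRatio_le_expansionRatio G))
    (expansionRatio_le_ultimateRatio G)

/-- The homomorphism `G × H → G + H` that projects to the summand containing `z` and then applies
an automorphism of that summand. -/
def projHom {V W : Type*} {G : SimpleGraph V} {H : SimpleGraph W} (z : V ⊕ W) (σ : G ≃g G)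
    (τ : H ≃g H) : tensorProd G H →g G ⊕g H where
  toFun p := z.elim (fun _ => Sum.inl (σ p.1)) (fun _ => Sum.inr (τ p.2))
  map_rel' {p q} h := by
    rcases z with v | w
    · simpa using (σ.map_rel_iff).2 h.1
    · simpa using (τ.map_rel_iff).2 h.2

/-- Indexing by a vertex z of the sum selects each summand with weight proportional to its order,
which makes the family uniform on all of G+H. -/
theorem ultimateRatio_sum_le {V W : Type*} [Fintype V] [Nonempty V] [Fintype W] [Nonempty W]
    {G : SimpleGraph V} {H : SimpleGraph W} (hG : VertexTransitive G) (hH : VertexTransitive H) :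
    ultimateRatio (G ⊕g H) ≤ indepRatio (tensorProd G H) := by
  classical
  have : Finite (G ≃g G) := DFunLike.finite _
  have := Fintype.ofFinite (G ≃g G)
  have : Finite (H ≃g H) := DFunLike.finite _
  have := Fintype.ofFinite (H ≃g H)
  have : Nonempty (G ≃g G) := ⟨SimpleGraph.Iso.refl⟩
  have : Nonempty (H ≃g H) := ⟨SimpleGraph.Iso.refl⟩
  obtain ⟨c, hc, hcard⟩ := hG.exists_card_filter
  obtain ⟨d, hd, hdcard⟩ := hH.exists_card_filter
  refine ultimateRatio_le_of_uniform
    (fun s : (V ⊕ W) × (G ≃g G) × (H ≃g H) => projHom s.1 s.2.1 s.2.2)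
    -- For a target v in G there are |V| choices of z, c of σ and |Aut H| of τ, and |V| c = |Aut G|;
    -- symmetrically for a target in H.
    (Fintype.card (G ≃g G) * Fintype.card (H ≃g H)) ?_
  rintro ⟨x, y⟩ (v | w)
  · have : (Finset.univ.filter fun s : (V ⊕ W) × (G ≃g G) × (H ≃g H) =>
        projHom s.1 s.2.1 s.2.2 (x, y) = Sum.inl v)
        = (Finset.univ.map Function.Embedding.inl) ×ˢ
          ((Finset.univ.filter fun σ : G ≃g G => σ x = v) ×ˢ Finset.univ) := by
      ext ⟨z | z, σ, τ⟩ 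
      all_goals
        simp only [Finset.mem_filter, Finset.mem_univ, true_and]
        simp [projHom]
    have hc' := hc x v
    rw [this, Finset.card_product, Finset.card_product, Finset.card_map, Finset.card_univ,
      Finset.card_univ, ← hcard, ← hc']
    ring_nf
  · have : (Finset.univ.filter fun s : (V ⊕ W) × (G ≃g G) × (H ≃g H) =>
        projHom s.1 s.2.1 s.2.2 (x, y) = Sum.inr w)
        = (Finset.univ.map Function.Embedding.inr) ×ˢ
          (Finset.univ ×ˢ (Finset.univ.filter fun τ : H ≃g H => τ y = w)) := by
      ext ⟨z | z, σ, τ⟩ 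
      all_goals
        simp only [Finset.mem_filter, Finset.mem_univ, true_and]
        simp [projHom]
    have hd' := hd y w
    rw [this, Finset.card_product, Finset.card_product, Finset.card_map, Finset.card_univ,
      Finset.card_univ, ← hdcard, ← hd']
    ring_nf

end TensorIndep

theorem mainTheorem8 {V W : Type*} [Fintype V] [Nonempty V] [Fintype W] [Nonempty W]
    (G : SimpleGraph V) (H : SimpleGraph W)
    (hG : TensorIndep.VertexTransitive G) (hH : TensorIndep.VertexTransitive H)
    (hfam : TensorIndep.IsKneser H ∨ TensorIndep.IsCircularComplete H ∨
      TensorIndep.IsCycleGraph H ∨ TensorIndep.IsCompleteBipartite H) :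
    TensorIndep.ultimateRatio (G ⊕g H) = TensorIndep.expansionRatio (G ⊕g H) ∧
      TensorIndep.expansionRatio (G ⊕g H) =
        max (TensorIndep.ultimateRatio G) (TensorIndep.ultimateRatio H) := by
  have h₁ := TensorIndep.expansionRatio_le_ultimateRatio (G ⊕g H)
  have h₂ := TensorIndep.max_expansionRatio_le_sum G H
  have h₃ := (TensorIndep.ultimateRatio_sum_le hG hH).trans
    (TensorIndep.indepRatio_tensorProd_le G H)
  rw [hG.ultimateRatio_eq, hH.ultimateRatio_eq]
  exact ⟨le_antisymm (h₃.trans h₂) h₁, le_antisymm (h₁.trans h₃) h₂⟩
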